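/- **Valuation property of functional quermassintegrals.** Let $n\ge 1$ and let $B$ be the closed Euclidean unit ball of $\mathbb R^n$. For a compact convex set $K\subset\mathbb R^n$, let $W_0(K),\dots,W_n(K)$ be its quermassintegrals, i.e. the coefficients in $$\mathrm{vol}_n(K+\rho B)=\sum_{i=0}^n\binom ni W_i(K)\,\rho^i\qquad(\rho\ge 0),$$ with $W_i(\emptyset)=0$. Let $\mathcal Q^n$ be the class of functions $f:\mathbb R^n\to[0,+\infty]$ that are not identically zero, quasi-concave (that is, $f((1-\lambda)x_0+\lambda x_1)\ge\min\{f(x_0),f(x_1)\}$ for all $x_0,x_1\in\mathbb R^n$ and $\lambda\in[0,1]$), upper semicontinuous, and satisfy $\lim_{\|x\|\to\infty}f(x)=0$. For $f\in\mathcal Q^n$ and $i=0,\dots,n$ put $$W_i(f)=\int_0^{+\infty}W_i(\{f\ge t\})\,dt\in[0,+\infty].$$ Write $f\vee g$ and $f\wedge g$ for the pointwise maximum and minimum. Let $f,g\in\mathcal Q^n$ be such that $f\vee g\in\mathcal Q^n$. Then $f\wedge g\in\mathcal Q^n$, and for every $i=0,1,\dots,n$, $$W_i(f\wedge g)+W_i(f\vee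 g)=W_i(f)+W_i(g).$$ -/

import Mathlib

open MeasureTheory Set Filter Topology
open scoped ENNReal Pointwise

/-- `SteinerExpansion K W` says that the volume of `K + ρ B`, where `B` is the closed Euclidean unit
ball of `ℝⁿ`, equals `∑_{i=0}^n (n choose i) W_i ρ^i` for every `ρ ≥ 0`. -/
def SteinerExpansion {n : ℕ} (K : Set (EuclideanSpace ℝ (Fin n))) (W : Fin (n + 1) → ℝ) : Prop :=
  ∀ ρ : ℝ, 0 ≤ ρ →
    (volume (K + ρ • Metric.closedBall (0 : EuclideanSpace ℝ (Fin n)) 1)).toReal =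
      ∑ i : Fin (n + 1), (n.choose (i : ℕ) : ℝ) * W i * ρ ^ (i : ℕ)

/-- The coefficients of such an expansion are determined by `K`. -/
theorem SteinerExpansion.unique {n : ℕ} {K : Set (EuclideanSpace ℝ (Fin n))}
    {W W' : Fin (n + 1) → ℝ} (h : SteinerExpansion K W) (h' : SteinerExpansion K W') : W = W' := by
  classical
  let P : (Fin (n + 1) → ℝ) → Polynomial ℝ := fun w =>
    ∑ i : Fin (n + 1), Polynomial.monomial (i : ℕ) ((n.choose (i : ℕ) : ℝ) * w i)
  have hP : P W = P W' := by
    apply Polynomial.eq_of_infinite_eval_eq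
    refine (Set.Ici_infinite (0 : ℝ)).mono ?_
    intro ρ hρ
    simp only [P, Set.mem_ofPred_eq, Polynomial.eval_finsetSum, Polynomial.eval_monomial]
    rw [← h ρ hρ, ← h' ρ hρ]
  funext i
  have hc : ∀ w, (P w).coeff (i : ℕ) = (n.choose (i : ℕ) : ℝ) * w i := by
    intro w
    simp [P, Polynomial.finsetSum_coeff, Polynomial.coeff_monomial, Fin.val_inj]
  have h0 : (n.choose (i : ℕ) : ℝ) ≠ 0 := by
    exact_mod_cast (Nat.choose_pos (Nat.lt_succ_iff.mp i.2)).ne'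
  have := congrArg (fun p => p.coeff (i : ℕ)) hP
  simp only [hc] at this
  exact mul_left_cancel₀ h0 this

open Classical in
/-- The `i`-th quermassintegral `W_i(K)`, for `i = 0, …, n`, of a compact convex set `K` in `ℝⁿ`: the
coefficient `W_i(K)` in the expansion `vol (K + ρ B) = ∑_{i=0}^n (n choose i) W_i(K) ρ^i`, `ρ ≥ 0`.
For the empty set all the coefficients vanish. (A set without such an expansion gets the value `0`;
compact convex sets do have one.) -/
noncomputable def quermassintegral {n : ℕ} (i : Fin (n + 1))
    (K : Set (EuclideanSpace ℝ (Fin n))) : ℝ :=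
  if h : ∃ W : Fin (n + 1) → ℝ, SteinerExpansion K W then h.choose i else 0

/-- The class `𝒬ⁿ` of functions `f : ℝⁿ → [0, ∞]` which are not identically zero, quasi-concave, upper
semicontinuous, and tend to `0` as `‖x‖ → ∞`. -/
structure IsQFunction {n : ℕ} (f : EuclideanSpace ℝ (Fin n) → ℝ≥0∞) : Prop where
  ne_zero : f ≠ 0
  quasiconcave : QuasiconcaveOn ℝ univ f
  upperSemicontinuous : UpperSemicontinuous f
  tendsto_zero : Tendsto f (Bornology.cobounded (EuclideanSpace ℝ (Fin n))) (𝓝 0)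

/-- The `i`-th quermassintegral of a function, `W_i(f) = ∫_0^∞ W_i({f ≥ t}) dt`, with values in
`[0, ∞]`. The quermassintegrals of compact convex sets are nonnegative, so `ENNReal.ofReal` only
changes the type of the integrand. -/
noncomputable def functionalQuermassintegral {n : ℕ} (i : Fin (n + 1))
    (f : EuclideanSpace ℝ (Fin n) → ℝ≥0∞) : ℝ≥0∞ :=
  ∫⁻ t in Ioi (0 : ℝ), ENNReal.ofReal (quermassintegral i {x | ENNReal.ofReal t ≤ f x})

/-! For each `t > 0` the superlevel sets of `f ⊓ g` and `f ⊔ g` are the intersection and the union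
of those of `f` and `g`. All four are compact and convex, possibly empty. So the claim reduces to
`W_i(K ∩ L) + W_i(K ∪ L) = W_i(K) + W_i(L)` when `K ∪ L` is convex, integrated over `t`.

The set identity comes from volume. Convexity of the union gives `(K ∩ L) + ρB = (K + ρB) ∩ (L +
ρB)`, so inclusion-exclusion applies to parallel bodies, and comparing coefficients in `ρ` gives the
result (`quermassintegral_inter_add_union`).

This needs Steiner's formula, which is proved here. Volume is affine in the length of an added
segment, hence polynomial with nonnegative coefficients along dilates of a zonotope. Zonotopes
approximate the ball, and a compactness argument on coefficients passes to the limit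
(`exists_steinerExpansion`). -/

/-! ### Volume along segments and zonotopes. -/

/-- Additivity and nonnegativity make `G` monotone. Squeezing `G (m * s)` between values at
consecutive integers bounds `m * |G s - s * G 1|` by `G 1` for every `m`. -/
theorem eq_mul_of_additive_of_nonneg {G : ℝ → ℝ} (h0 : ∀ s, 0 ≤ s → 0 ≤ G s)
    (hadd : ∀ s t, 0 ≤ s → 0 ≤ t → G (s + t) = G s + G t) {s : ℝ} (hs : 0 ≤ s) :
    G s = s * G 1 := by
  have hzero : G 0 = 0 := by
    have := hadd 0 0 le_rfl le_rfl
    simp only [add_zero] at this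
    linarith
  have hmul : ∀ (m : ℕ) (r : ℝ), 0 ≤ r → G (m * r) = m * G r := by
    intro m r hr
    induction m with
    | zero => simp [hzero]
    | succ k ih =>
      have : ((k + 1 : ℕ) : ℝ) * r = k * r + r := by push_cast; ring
      rw [this, hadd _ _ (by positivity) hr, ih]
      push_cast; ring
  have hmono : ∀ a b, 0 ≤ a → a ≤ b → G a ≤ G b := by
    intro a b ha hab
    have := hadd a (b - a) ha (by linarith)
    rw [add_sub_cancel] at this
    linarith [h0 (b - a) (by linarith)]
  have hone : ∀ m : ℕ, G m = m * G 1 := fun m => by simpa using hmul m 1 zero_le_one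
  have hbound : ∀ m : ℕ, (m : ℝ) * |G s - s * G 1| ≤ G 1 := by
    intro m
    have h1 := Nat.floor_le (show 0 ≤ (m : ℝ) * s by positivity)
    have h2 := (Nat.lt_floor_add_one ((m : ℝ) * s)).le
    have h3 := hmono _ _ (Nat.cast_nonneg _) h1
    have h4 := hmono _ _ (by positivity) h2
    rw [show ((⌊(m : ℝ) * s⌋₊ : ℝ) + 1) = ((⌊(m : ℝ) * s⌋₊ + 1 : ℕ) : ℝ) by push_cast; rfl] at h4
    rw [hone, hmul m s hs] at h3 h4
    push_cast at h4
    have hG := h0 1 zero_le_one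
    rw [← abs_of_nonneg (show (0 : ℝ) ≤ m by positivity), ← abs_mul, abs_le]
    constructor <;> nlinarith
  by_contra hne
  have hpos : 0 < |G s - s * G 1| := abs_pos.2 (sub_ne_zero.2 hne)
  obtain ⟨m, hm⟩ := exists_nat_gt (G 1 / |G s - s * G 1|)
  rw [div_lt_iff₀ hpos] at hm
  linarith [hbound m]

section

variable {E : Type*} [NormedAddCommGroup E] [InnerProductSpace ℝ E]

/-- The set `K` swept along the vectors `r • d` for `r ∈ [a, b]`. -/
def sweep (K : Set E) (d : E) (a b : ℝ) : Set E := K + (fun r : ℝ => r • d) '' Icc a b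

theorem mem_sweep {K : Set E} {d : E} {a b : ℝ} {x : E} :
    x ∈ sweep K d a b ↔ ∃ r ∈ Icc a b, x - r • d ∈ K := by
  constructor
  · rintro ⟨k, hk, _, ⟨r, hr, rfl⟩, rfl⟩
    exact ⟨r, hr, by simpa using hk⟩
  · rintro ⟨r, hr, h⟩
    exact ⟨_, h, _, ⟨r, hr, rfl⟩, by simp⟩

theorem isCompact_sweep {K : Set E} (hK : IsCompact K) (d : E) (a b : ℝ) :
    IsCompact (sweep K d a b) :=
  hK.add (isCompact_Icc.image (by fun_prop))

theorem sweep_add {K : Set E} (d : E) (a b c : ℝ) :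
    sweep K d (a + c) (b + c) = (c • d) +ᵥ sweep K d a b := by
  ext x
  rw [mem_vadd_set_iff_neg_vadd_mem, mem_sweep, mem_sweep]
  constructor
  · rintro ⟨r, hr, h⟩
    refine ⟨r - c, ⟨by linarith [hr.1], by linarith [hr.2]⟩, ?_⟩
    convert h using 1
    simp only [vadd_eq_add, sub_smul]; abel
  · rintro ⟨r, hr, h⟩
    refine ⟨r + c, ⟨by linarith [hr.1], by linarith [hr.2]⟩, ?_⟩
    convert h using 1
    simp only [vadd_eq_add, add_smul]; abel

theorem sweep_self (K : Set E) (d : E) (a : ℝ) : sweep K d a a = (a • d) +ᵥ K := by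
  ext x
  rw [mem_vadd_set_iff_neg_vadd_mem, mem_sweep]
  simp [sub_eq_neg_add]

theorem sweep_union {K : Set E} (d : E) {a b c : ℝ} (hab : a ≤ b) (hbc : b ≤ c) :
    sweep K d a b ∪ sweep K d b c = sweep K d a c := by
  rw [sweep, sweep, ← add_union, ← image_union, Icc_union_Icc_eq_Icc hab hbc, sweep]

/-- If `x - r • d` and `x - r' • d` lie in `K` with `r ≤ b ≤ r'`, convexity puts `x - b • d` in `K`.
Adjacent sweeps thus overlap in a mere translate of `K`, which makes volume increments additive. -/
theorem sweep_inter {K : Set E} (hK : Convex ℝ K) (d : E) {a b c : ℝ} (hab : a ≤ b)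
    (hbc : b ≤ c) : sweep K d a b ∩ sweep K d b c = sweep K d b b := by
  ext x
  simp only [mem_inter_iff, mem_sweep]
  constructor
  · rintro ⟨⟨r, hr, h⟩, r', hr', h'⟩
    refine ⟨b, by simp, ?_⟩
    have hb : b ∈ segment ℝ r r' := by
      rw [segment_eq_Icc (hr.2.trans hr'.1)]; exact ⟨hr.2, hr'.1⟩
    obtain ⟨p, q, hp, hq, hpq, rfl⟩ := hb
    have := hK h h' hp hq hpq
    convert this using 1
    have hx : x = (p + q) • x := by rw [hpq, one_smul]
    conv_lhs => rw [hx]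
    simp only [smul_eq_mul]
    module
  · rintro ⟨r, hr, h⟩
    have : r = b := le_antisymm hr.2 hr.1
    subst this
    exact ⟨⟨r, ⟨hab, le_rfl⟩, h⟩, r, ⟨le_rfl, hbc⟩, h⟩

theorem add_smul_segment (K : Set E) (a b : E) {s : ℝ} (hs : 0 ≤ s) :
    K + s • segment ℝ a b = (s • a) +ᵥ sweep K (b - a) 0 s := by
  rw [segment_eq_image', sweep, ← add_vadd_comm]
  congr 1
  ext x
  constructor
  · rintro ⟨_, ⟨θ, hθ, rfl⟩, rfl⟩
    refine ⟨_, ⟨s * θ, ⟨mul_nonneg hs hθ.1, mul_le_of_le_one_right hs hθ.2⟩, rfl⟩, ?_⟩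
    simp only [vadd_eq_add]; module
  · rintro ⟨_, ⟨r, hr, rfl⟩, rfl⟩
    rcases hs.eq_or_lt with rfl | hs
    · have : r = 0 := le_antisymm hr.2 hr.1
      subst this
      exact ⟨a, ⟨0, by simp, by simp⟩, by simp⟩
    · refine ⟨_, ⟨r / s, ⟨div_nonneg hr.1 hs.le, (div_le_one hs).2 hr.2⟩, rfl⟩, ?_⟩
      simp only [vadd_eq_add, smul_add, smul_smul]
      rw [mul_div_cancel₀ _ hs.ne']

/-- A nonnegative functional on compact convex sets that is affine along dilated segments. -/
structure IsSegmentAffine (Φ : Set E → ℝ) : Prop where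
  nonneg : ∀ K, Convex ℝ K → IsCompact K → 0 ≤ Φ K
  affine : ∀ K, Convex ℝ K → IsCompact K → ∀ a b : E, ∀ s : ℝ, 0 ≤ s →
    Φ (K + s • segment ℝ a b) = Φ K + s * (Φ (K + segment ℝ a b) - Φ K)

theorem isCompact_segment (a b : E) : IsCompact (segment ℝ a b) := by
  rw [segment_eq_image']
  exact isCompact_Icc.image (by fun_prop)

/-- A function affine and nonnegative on a half-line has nonnegative slope. Affinity survives
differencing because Minkowski sums commute. -/
theorem IsSegmentAffine.difference {Φ : Set E → ℝ} (h : IsSegmentAffine Φ) (a b : E) :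
    IsSegmentAffine fun K => Φ (K + segment ℝ a b) - Φ K where
  nonneg K hK hc := by
    by_contra! hneg
    obtain ⟨m, hm⟩ := exists_nat_gt (Φ K / -(Φ (K + segment ℝ a b) - Φ K))
    rw [div_lt_iff₀ (by linarith)] at hm
    have h1 := h.affine K hK hc a b m (Nat.cast_nonneg m)
    have h2 := h.nonneg (K + (m : ℝ) • segment ℝ a b) (hK.add ((convex_segment (𝕜 := ℝ) a b).smul (m : ℝ)))
      (hc.add ((isCompact_segment a b).smul _))
    linarith
  affine K hK hc c d s hs := by
    have h1 := h.affine K hK hc c d s hs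
    have h2 := h.affine (K + segment ℝ a b) (hK.add (convex_segment (𝕜 := ℝ) a b))
      (hc.add (isCompact_segment a b)) c d s hs
    rw [h1, add_right_comm K (s • segment ℝ c d), h2, add_right_comm K (segment ℝ c d)]
    ring

/-- The zonotope that is the Minkowski sum of the segments `[-u, u]`. -/
def zonotope (l : List E) : Set E := (l.map fun u => segment ℝ (-u) u).sum

theorem zonotope_cons (u : E) (l : List E) :
    zonotope (u :: l) = segment ℝ (-u) u + zonotope l := by simp [zonotope]

theorem convex_zonotope (l : List E) : Convex ℝ (zonotope l) := by
  induction l with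
  | nil => exact convex_singleton (𝕜 := ℝ) (0 : E)
  | cons u l ih => rw [zonotope_cons]; exact (convex_segment _ _).add ih

theorem isCompact_zonotope (l : List E) : IsCompact (zonotope l) := by
  induction l with
  | nil => simp [zonotope]
  | cons u l ih => rw [zonotope_cons]; exact (isCompact_segment _ _).add ih

/-- Splitting off one segment `S` gives `Φ(K + ρZ + ρS) = Φ(K + ρZ) + ρ ΔΦ(K + ρZ)`, and the
difference `ΔΦ` is again segment-affine. The induction therefore has to range over all such `Φ`. -/
theorem IsSegmentAffine.exists_polynomial (l : List E) {Φ : Set E → ℝ} (h : IsSegmentAffine Φ)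
    {K : Set E} (hK : Convex ℝ K) (hc : IsCompact K) :
    ∃ p : Polynomial ℝ, (∀ k, 0 ≤ p.coeff k) ∧
      ∀ ρ : ℝ, 0 ≤ ρ → Φ (K + ρ • zonotope l) = p.eval ρ := by
  induction l generalizing Φ with
  | nil =>
    refine ⟨Polynomial.C (Φ K), fun k => ?_, fun ρ _ => by simp [zonotope]⟩
    rw [Polynomial.coeff_C]
    split_ifs
    exacts [h.nonneg K hK hc, le_rfl]
  | cons u l ih =>
    obtain ⟨p, hp, hp'⟩ := ih h
    obtain ⟨q, hq, hq'⟩ := ih (h.difference (-u) u)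
    refine ⟨p + Polynomial.X * q, fun k => ?_, fun ρ hρ => ?_⟩
    · rw [Polynomial.coeff_add]
      refine add_nonneg (hp k) ?_
      cases k with
      | zero => simp
      | succ k => simpa using hq k
    · rw [zonotope_cons, smul_add, add_comm (ρ • segment ℝ (-u) u), ← add_assoc,
        h.affine _ (hK.add ((convex_zonotope l).smul ρ)) (hc.add ((isCompact_zonotope l).smul ρ))
          _ _ _ hρ, hp' ρ hρ, ← hp' ρ hρ, hq' ρ hρ, hp' ρ hρ]
      simp

variable [FiniteDimensional ℝ E] [MeasurableSpace E] [BorelSpace E]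

theorem volume_add_smul_segment {K : Set E} (hK : Convex ℝ K) (hc : IsCompact K) (a b : E)
    {s : ℝ} (hs : 0 ≤ s) :
    (volume (K + s • segment ℝ a b)).toReal = (volume K).toReal +
      s * ((volume (K + segment ℝ a b)).toReal - (volume K).toReal) := by
  have hvol : ∀ r : ℝ, 0 ≤ r → (volume (K + r • segment ℝ a b)).toReal =
      (volume (sweep K (b - a) 0 r)).toReal := by
    intro r hr
    rw [add_smul_segment K a b hr, measure_vadd]
  have hfin : ∀ p q, volume (sweep K (b - a) p q) ≠ ∞ :=
    fun p q => (isCompact_sweep hc _ p q).measure_lt_top.ne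
  have h1 := hvol 1 zero_le_one
  rw [one_smul] at h1
  rw [hvol s hs, h1]
  have key := eq_mul_of_additive_of_nonneg
    (G := fun r => (volume (sweep K (b - a) 0 r)).toReal - (volume K).toReal) ?_ ?_ hs
  · linarith
  · intro r hr
    have : volume K ≤ volume (sweep K (b - a) 0 r) := by
      refine measure_mono fun x hx => mem_sweep.2 ⟨0, ⟨le_rfl, hr⟩, by simpa using hx⟩
    linarith [ENNReal.toReal_mono (hfin 0 r) this]
  · intro r t hr ht
    have hm := measure_union_add_inter (μ := volume) (sweep K (b - a) 0 r)
      (isCompact_sweep hc (b - a) r (r + t)).measurableSet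
    rw [sweep_union _ hr (by linarith), sweep_inter hK _ hr (by linarith), sweep_self,
      measure_vadd] at hm
    have h2 := sweep_add (K := K) (b - a) 0 t r
    rw [zero_add, add_comm t r] at h2
    rw [h2, measure_vadd] at hm
    have := congrArg ENNReal.toReal hm
    rw [ENNReal.toReal_add (hfin _ _) hc.measure_lt_top.ne,
      ENNReal.toReal_add (hfin _ _) (hfin _ _)] at this
    linarith

theorem isSegmentAffine_volume : IsSegmentAffine fun K : Set E => (volume K).toReal where
  nonneg _ _ _ := ENNReal.toReal_nonneg
  affine _ hK hc a b _ hs := volume_add_smul_segment hK hc a b hs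

end

/-! ### Approximating the ball by zonotopes. -/

section

variable {E : Type*} [NormedAddCommGroup E] [InnerProductSpace ℝ E]

/-- The support function of the zonotope `zonotope l`. -/
def zonotopeSupport (l : List E) (x : E) : ℝ := (l.map fun u => |inner ℝ u x|).sum

theorem zonotopeSupport_cons (u : E) (l : List E) (x : E) :
    zonotopeSupport (u :: l) x = |inner ℝ u x| + zonotopeSupport l x := by simp [zonotopeSupport]

theorem zonotopeSupport_append (l l' : List E) (x : E) :
    zonotopeSupport (l ++ l') x = zonotopeSupport l x + zonotopeSupport l' x := by
  simp [zonotopeSupport]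

theorem zonotopeSupport_map_smul (l : List E) {c : ℝ} (hc : 0 ≤ c) (x : E) :
    zonotopeSupport (l.map (c • ·)) x = c * zonotopeSupport l x := by
  induction l with
  | nil => simp [zonotopeSupport]
  | cons u l ih =>
    rw [List.map_cons, zonotopeSupport_cons, ih, zonotopeSupport_cons, inner_smul_left, abs_mul]
    simp [abs_of_nonneg hc, mul_add]

theorem zonotopeSupport_smul (l : List E) {c : ℝ} (hc : 0 ≤ c) (x : E) :
    zonotopeSupport l (c • x) = c * zonotopeSupport l x := by
  induction l with
  | nil => simp [zonotopeSupport]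
  | cons u l ih =>
    rw [zonotopeSupport_cons, ih, zonotopeSupport_cons, inner_smul_right, abs_mul,
      abs_of_nonneg hc]
    ring

theorem inner_le_zonotopeSupport (l : List E) (x : E) {z : E} (hz : z ∈ zonotope l) :
    inner ℝ z x ≤ zonotopeSupport l x := by
  induction l generalizing z with
  | nil =>
    have : z = 0 := by simpa [zonotope] using hz
    simp [this, zonotopeSupport]
  | cons u l ih =>
    rw [zonotope_cons] at hz
    obtain ⟨_, ⟨a, b, ha, hb, hab, rfl⟩, z', hz', rfl⟩ := hz
    rw [zonotopeSupport_cons]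
    simp only [inner_add_left, inner_smul_left, inner_neg_left, RCLike.conj_to_real]
    have h1 := le_abs_self (inner ℝ u x)
    have h2 := neg_abs_le (inner ℝ u x)
    have h3 := ih hz'
    nlinarith

theorem exists_inner_eq_zonotopeSupport (l : List E) (x : E) :
    ∃ z ∈ zonotope l, inner ℝ z x = zonotopeSupport l x := by
  induction l with
  | nil => exact ⟨0, by simp [zonotope], by simp [zonotopeSupport]⟩
  | cons u l ih =>
    obtain ⟨z, hz, h⟩ := ih
    rw [zonotope_cons]
    rcases le_total 0 (inner ℝ u x) with hu | hu
    · refine ⟨u + z, add_mem_add (right_mem_segment ℝ _ _) hz, ?_⟩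
      rw [inner_add_left, h, zonotopeSupport_cons, abs_of_nonneg hu]
    · refine ⟨-u + z, add_mem_add (left_mem_segment ℝ _ _) hz, ?_⟩
      rw [inner_add_left, h, zonotopeSupport_cons, abs_of_nonpos hu, inner_neg_left]

theorem zonotope_subset_closedBall {l : List E} {r : ℝ} (hr : 0 ≤ r)
    (h : ∀ x, zonotopeSupport l x ≤ r * ‖x‖) : zonotope l ⊆ Metric.closedBall 0 r := by
  intro z hz
  rw [mem_closedBall_zero_iff]
  have h1 := (inner_le_zonotopeSupport l z hz).trans (h z)
  rw [real_inner_self_eq_norm_mul_norm] at h1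
  rcases (norm_nonneg z).eq_or_lt with h0 | h0
  · rw [← h0]
    exact hr
  · exact le_of_mul_le_mul_right h1 h0

/-- A point `y` of the ball outside the zonotope would be separated by some `x`, giving `⟨y, x⟩ >
r‖x‖`, against Cauchy-Schwarz. -/
theorem closedBall_subset_zonotope [CompleteSpace E] {l : List E} {r : ℝ}
    (h : ∀ x, r * ‖x‖ ≤ zonotopeSupport l x) : Metric.closedBall 0 r ⊆ zonotope l := by
  intro y hy
  rw [mem_closedBall_zero_iff] at hy
  by_contra hyz
  obtain ⟨φ, c, hφ, hc⟩ := geometric_hahn_banach_closed_point (convex_zonotope l)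
    (isCompact_zonotope l).isClosed hyz
  let x := (InnerProductSpace.toDual ℝ E).symm φ
  have hx : ∀ z, φ z = inner ℝ z x := fun z => by
    rw [real_inner_comm, InnerProductSpace.toDual_symm_apply]
  obtain ⟨z, hz, hzx⟩ := exists_inner_eq_zonotopeSupport l x
  have h1 := hφ z hz
  rw [hx] at h1 hc
  have h2 := real_inner_le_norm y x
  nlinarith [h x, norm_nonneg x]

theorem convex_setOf_zonotopeSupport {S : Set E} :
    Convex ℝ {φ : C(S, ℝ) | ∃ l : List E, ∀ x : S, φ x = zonotopeSupport l x} := by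
  rintro φ ⟨l, hl⟩ ψ ⟨l', hl'⟩ a b ha hb -
  refine ⟨l.map (a • ·) ++ l'.map (b • ·), fun x => ?_⟩
  rw [zonotopeSupport_append, zonotopeSupport_map_smul _ ha, zonotopeSupport_map_smul _ hb,
    ← hl, ← hl']
  rfl

variable [FiniteDimensional ℝ E] [MeasurableSpace E] [BorelSpace E]

/-- The reflection taking `x` to `y` preserves volume and the ball. -/
theorem integral_closedBall_abs_inner (x y : E) (h : ‖x‖ = ‖y‖) :
    ∫ u in Metric.closedBall (0 : E) 1, |inner ℝ u x| =
      ∫ u in Metric.closedBall (0 : E) 1, |inner ℝ u y| := by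
  let R := (ℝ ∙ (x - y))ᗮ.reflection
  have hR : R x = y := Submodule.reflection_sub h
  have h1 := (LinearIsometryEquiv.measurePreserving R).setIntegral_preimage_emb
    R.toHomeomorph.measurableEmbedding (fun u => |inner ℝ u y|) (Metric.closedBall 0 1)
  have h2 : R ⁻¹' Metric.closedBall 0 1 = Metric.closedBall 0 1 := by
    ext u; simp
  rw [h2] at h1
  rw [← h1]
  congr 1 with u
  rw [← hR, R.inner_map_map]

theorem integral_closedBall_abs_inner_pos {x : E} (hx : x ≠ 0) :
    0 < ∫ u in Metric.closedBall (0 : E) 1, |inner ℝ u x| := by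
  have hcont : Continuous fun u : E => |inner ℝ u x| := by fun_prop
  rw [setIntegral_pos_iff_support_of_nonneg_ae (ae_of_all _ fun u => abs_nonneg _)
    (hcont.continuousOn.integrableOn_compact (isCompact_closedBall 0 1))]
  have hopen : IsOpen ((Function.support fun u : E => |inner ℝ u x|) ∩ Metric.ball 0 1) :=
    hcont.isOpen_support.inter Metric.isOpen_ball
  refine (hopen.measure_pos volume ⟨(2 * ‖x‖)⁻¹ • x, ?_, ?_⟩).trans_le
    (measure_mono (inter_subset_inter_right _ Metric.ball_subset_closedBall))
  · simp [inner_smul_left, hx]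
  · have := norm_pos_iff.2 hx
    rw [mem_ball_zero_iff, norm_smul, Real.norm_of_nonneg (by positivity)]
    field_simp
    norm_num

/-- By rotation invariance the average of `|⟨u, x⟩|` over `u` in the ball is `c‖x‖`. Taken in `C(B,
ℝ)`, this average lies in the closure of the convex set of zonotope supports, so some zonotope
support is uniformly close to it on the ball; homogeneity does the rest. -/
theorem exists_zonotopeSupport_near [Nontrivial E] : ∃ c : ℝ, 0 < c ∧ ∀ δ : ℝ, 0 < δ →
    ∃ l : List E, ∀ x, |zonotopeSupport l x - c * ‖x‖| ≤ δ * ‖x‖ := by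
  obtain ⟨e, he⟩ := exists_norm_eq E (zero_le_one (α := ℝ))
  have he0 : e ≠ 0 := by rintro rfl; simp at he
  let B := Metric.closedBall (0 : E) 1
  have hB : IsCompact B := isCompact_closedBall 0 1
  have : CompactSpace B := isCompact_iff_compactSpace.1 hB
  let F : C(E, C(B, ℝ)) := ContinuousMap.curry ⟨fun p => |inner ℝ p.1 (p.2 : E)|, by fun_prop⟩
  have hFint : IntegrableOn F B := F.continuous.continuousOn.integrableOn_compact hB
  have hB0 : volume B ≠ 0 := (Metric.measure_closedBall_pos _ _ one_pos).ne'
  have hmem := (convex_setOf_zonotopeSupport (S := B)).set_average_mem_closure hB0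
    hB.measure_lt_top.ne (ae_of_all _ fun u => ⟨[u], fun x => by simp [zonotopeSupport, F]⟩) hFint
  set a : ℝ := (volume.real B)⁻¹
  have ha : 0 < a := by
    have : 0 < volume.real B := ENNReal.toReal_pos hB0 hB.measure_lt_top.ne
    positivity
  set I := ∫ u in B, |inner ℝ u e|
  have hI : 0 < I := integral_closedBall_abs_inner_pos he0
  refine ⟨a * I, mul_pos ha hI, fun δ hδ => ?_⟩
  obtain ⟨φ, ⟨l, hl⟩, hφ⟩ := Metric.mem_closure_iff.1 hmem δ hδ
  refine ⟨l, fun x => ?_⟩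
  rcases eq_or_ne x 0 with rfl | hx
  · have := zonotopeSupport_smul l le_rfl (0 : E)
    simp only [smul_zero, zero_mul] at this
    simp [this]
  have hxn := norm_pos_iff.2 hx
  have hy1 : ‖‖x‖⁻¹ • x‖ = 1 := by rw [norm_smul, norm_inv, norm_norm, inv_mul_cancel₀ hxn.ne']
  let y : B := ⟨‖x‖⁻¹ • x, by simp [B, hy1]⟩
  have h1 := (ContinuousMap.dist_apply_le_dist (f := ⨍ u in B, F u) (g := φ) y).trans hφ.le
  rw [hl, setAverage_eq, ContinuousMap.smul_apply, ContinuousMap.integral_apply hFint,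
    smul_eq_mul] at h1
  have h2 : ∫ u in B, F u y = I := integral_closedBall_abs_inner _ _ (hy1.trans he.symm)
  rw [h2, dist_comm, Real.dist_eq, zonotopeSupport_smul _ (by positivity)] at h1
  have h3 : zonotopeSupport l x - a * I * ‖x‖ =
      (‖x‖⁻¹ * zonotopeSupport l x - a * I) * ‖x‖ := by field_simp
  rw [h3, abs_mul, abs_of_pos hxn]
  exact mul_le_mul_of_nonneg_right h1 hxn.le

theorem exists_zonotope_near_closedBall {ε : ℝ} (hε : 0 < ε) : ∃ l : List E,
    Metric.closedBall 0 1 ⊆ zonotope l ∧ zonotope l ⊆ Metric.closedBall 0 (1 + ε) := by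
  rcases subsingleton_or_nontrivial E with hE | hE
  · refine ⟨[], fun x _ => ?_, fun x _ => ?_⟩ <;> rw [Subsingleton.elim x 0] <;>
      simp [zonotope]
    positivity
  obtain ⟨c, hc, h⟩ := exists_zonotopeSupport_near (E := E)
  -- Chosen so that `(c + δ) / (c - δ) = 1 + ε`.
  set δ := c * ε / (2 + ε)
  have hδ : 0 < δ := by positivity
  have hδc : δ * (2 + ε) = c * ε := by simp only [δ]; field_simp
  have hcδ : 0 < c - δ := by nlinarith
  obtain ⟨l, hl⟩ := h δ hδ
  refine ⟨l.map ((c - δ)⁻¹ • ·), closedBall_subset_zonotope fun x => ?_,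
    zonotope_subset_closedBall (by linarith) fun x => ?_⟩ <;>
  rw [zonotopeSupport_map_smul _ (by positivity)] <;> have h1 := abs_le.1 (hl x)
  · rw [inv_mul_eq_div, le_div_iff₀ hcδ]
    linarith [h1.1]
  · rw [inv_mul_le_iff₀ hcδ]
    have : (c - δ) * ((1 + ε) * ‖x‖) = (c + δ) * ‖x‖ := by linear_combination (-‖x‖) * hδc
    linarith [h1.2]

end

/-! ### Steiner's formula and additivity on convex unions. -/

section

theorem smul_unitClosedBall_eq {E : Type*} [NormedAddCommGroup E] [NormedSpace ℝ E] {ρ : ℝ}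
    (hρ : 0 ≤ ρ) : ρ • Metric.closedBall (0 : E) 1 = Metric.closedBall 0 ρ := by
  rw [smul_closedBall _ _ zero_le_one, smul_zero, mul_one, Real.norm_of_nonneg hρ]

/-- A polynomial with nonnegative coefficients that grows at most like `(1 + ρ) ^ n` has degree at
most `n`. -/
theorem natDegree_le_of_nonneg_of_growth {p : Polynomial ℝ} (hp : ∀ k, 0 ≤ p.coeff k) {n : ℕ}
    {C : ℝ} (h : ∀ ρ : ℝ, 0 ≤ ρ → p.eval ρ ≤ C * (1 + ρ) ^ n) : p.natDegree ≤ n := by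
  rw [Polynomial.natDegree_le_iff_coeff_eq_zero]
  intro k hk
  by_contra hne
  have hpos : 0 < p.coeff k := lt_of_le_of_ne (hp k) (Ne.symm hne)
  have hkey : ∀ ρ : ℝ, 1 ≤ ρ → p.coeff k * ρ ≤ C * 2 ^ n := by
    intro ρ hρ
    have h1 : p.coeff k * ρ ^ k ≤ p.eval ρ := by
      rw [Polynomial.eval_eq_sum_range]
      refine Finset.single_le_sum (f := fun i => p.coeff i * ρ ^ i)
        (fun i _ => mul_nonneg (hp i) (by positivity)) ?_
      rw [Finset.mem_range]
      exact Nat.lt_succ_of_le (Polynomial.le_natDegree_of_ne_zero hne)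
    have h2 : ρ ^ (n + 1) ≤ ρ ^ k := pow_le_pow_right₀ hρ hk
    have h3 := h ρ (by linarith)
    have hC : 0 ≤ C := by
      have h0 := h 0 le_rfl
      have h0' : 0 ≤ p.eval 0 := by
        rw [← Polynomial.coeff_zero_eq_eval_zero]; exact hp 0
      simp at h0
      linarith
    have h4 : (1 + ρ) ^ n ≤ (2 * ρ) ^ n := by gcongr; linarith
    have h5 : p.coeff k * ρ * ρ ^ n ≤ C * 2 ^ n * ρ ^ n := by
      calc p.coeff k * ρ * ρ ^ n = p.coeff k * ρ ^ (n + 1) := by ring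
        _ ≤ p.coeff k * ρ ^ k := by gcongr
        _ ≤ C * (1 + ρ) ^ n := h1.trans h3
        _ ≤ C * (2 * ρ) ^ n := by gcongr
        _ = C * 2 ^ n * ρ ^ n := by ring
    exact le_of_mul_le_mul_right h5 (by positivity)
  have h1 := hkey (max 1 (C * 2 ^ n / p.coeff k + 1)) (le_max_left _ _)
  have h2 : p.coeff k * (C * 2 ^ n / p.coeff k + 1) ≤ _ :=
    (mul_le_mul_of_nonneg_left (le_max_right _ _) hpos.le).trans h1
  rw [mul_add, mul_div_cancel₀ _ hpos.ne'] at h2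
  linarith

variable {n : ℕ} {K : Set (EuclideanSpace ℝ (Fin n))}

theorem volume_add_smul_zonotope_eq_polynomial (hK : Convex ℝ K) (hc : IsCompact K)
    (l : List (EuclideanSpace ℝ (Fin n))) :
    ∃ p : Polynomial ℝ, (∀ k, 0 ≤ p.coeff k) ∧ p.natDegree ≤ n ∧
      ∀ ρ : ℝ, 0 ≤ ρ → (volume (K + ρ • zonotope l)).toReal = p.eval ρ := by
  obtain ⟨p, hp, hp'⟩ := isSegmentAffine_volume.exists_polynomial l hK hc
  refine ⟨p, hp, ?_, hp'⟩
  obtain ⟨R, hR⟩ := (hc.union (isCompact_zonotope l)).isBounded.subset_closedBall 0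
  rw [union_subset_iff] at hR
  set R' := max R 0
  have hR' : 0 ≤ R' := le_max_right _ _
  have hKR := hR.1.trans (Metric.closedBall_subset_closedBall (le_max_left R 0))
  have hZR := hR.2.trans (Metric.closedBall_subset_closedBall (le_max_left R 0))
  refine natDegree_le_of_nonneg_of_growth hp (n := n)
    (C := R' ^ n * (volume (Metric.closedBall (0 : EuclideanSpace ℝ (Fin n)) 1)).toReal) ?_
  intro ρ hρ
  rw [← hp' ρ hρ]
  -- The volume of this ball grows like `(1 + ρ) ^ n`, which caps the degree.
  have hsub : K + ρ • zonotope l ⊆ Metric.closedBall 0 (R' * (1 + ρ)) := by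
    rintro _ ⟨x, hx, _, ⟨z, hz, rfl⟩, rfl⟩
    have h1 := mem_closedBall_zero_iff.1 (hKR hx)
    have h2 := mem_closedBall_zero_iff.1 (hZR hz)
    rw [mem_closedBall_zero_iff]
    refine (norm_add_le _ _).trans ?_
    simp only [norm_smul, Real.norm_of_nonneg hρ]
    nlinarith
  have h1 := ENNReal.toReal_mono (isCompact_closedBall _ _).measure_lt_top.ne
    (measure_mono (μ := volume) hsub)
  have h2 : volume (Metric.closedBall (0 : EuclideanSpace ℝ (Fin n)) (R' * (1 + ρ))) =
      ENNReal.ofReal ((R' * (1 + ρ)) ^ n) * volume (Metric.closedBall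
        (0 : EuclideanSpace ℝ (Fin n)) 1) := by
    have := Measure.addHaar_closedBall' volume (0 : EuclideanSpace ℝ (Fin n))
      (r := R' * (1 + ρ)) (by positivity)
    simpa using this
  rw [h2, ENNReal.toReal_mul, ENNReal.toReal_ofReal (by positivity)] at h1
  calc _ ≤ _ := h1
    _ = _ := by rw [mul_pow]; ring

/-- The sets are squeezed between `K + ρB` and its closed thickening of radius `ρ / (m + 1)`. -/
theorem tendsto_volume_add_smul_of_near_closedBall (hc : IsCompact K)
    {Z : ℕ → Set (EuclideanSpace ℝ (Fin n))} (hZ : ∀ m, Metric.closedBall 0 1 ⊆ Z m)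
    (hZ' : ∀ m : ℕ, Z m ⊆ Metric.closedBall 0 (1 + 1 / ((m : ℝ) + 1))) {ρ : ℝ} (hρ : 0 ≤ ρ) :
    Tendsto (fun m => (volume (K + ρ • Z m)).toReal) atTop
      (𝓝 (volume (K + ρ • Metric.closedBall (0 : EuclideanSpace ℝ (Fin n)) 1)).toReal) := by
  have hc' : IsCompact (K + ρ • Metric.closedBall (0 : EuclideanSpace ℝ (Fin n)) 1) :=
    hc.add ((isCompact_closedBall _ _).smul ρ)
  refine (ENNReal.tendsto_toReal hc'.measure_lt_top.ne).comp ?_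
  have hlim : Tendsto (fun m : ℕ => ρ * (1 / ((m : ℝ) + 1))) atTop (𝓝 0) := by
    simpa using tendsto_one_div_add_atTop_nhds_zero_nat.const_mul ρ
  refine tendsto_of_tendsto_of_tendsto_of_le_of_le tendsto_const_nhds
    ((tendsto_measure_cthickening_of_isCompact (μ := volume) hc').comp hlim)
    (fun m => measure_mono (add_subset_add_left (smul_set_mono (hZ m)))) fun m => ?_
  have hm : 0 ≤ ρ * (1 / ((m : ℝ) + 1)) := by positivity
  refine measure_mono ?_
  rw [← hc'.add_closedBall_zero hm, smul_unitClosedBall_eq hρ, add_assoc,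
    closedBall_add_closedBall hρ hm]
  refine add_subset_add_left ((smul_set_mono (hZ' m)).trans ?_)
  rw [smul_closedBall _ _ (by positivity), smul_zero, Real.norm_of_nonneg hρ, add_zero, mul_add,
    mul_one]

theorem exists_steinerExpansion (hK : Convex ℝ K) (hc : IsCompact K) :
    ∃ W : Fin (n + 1) → ℝ, (∀ i, 0 ≤ W i) ∧ SteinerExpansion K W := by
  choose l hl hl' using fun m : ℕ => exists_zonotope_near_closedBall
    (E := EuclideanSpace ℝ (Fin n)) (ε := 1 / ((m : ℝ) + 1)) (by positivity)
  choose p hp hdeg hp' using fun m => volume_add_smul_zonotope_eq_polynomial hK hc (l m)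
  have hlim := fun (ρ : ℝ) (hρ : 0 ≤ ρ) =>
    tendsto_volume_add_smul_of_near_closedBall hc hl hl' hρ
  have heval : ∀ m (ρ : ℝ), (p m).eval ρ = ∑ i : Fin (n + 1), (p m).coeff i * ρ ^ (i : ℕ) := by
    intro m ρ
    rw [Polynomial.eval_eq_sum_range' (Nat.lt_succ_of_le (hdeg m)), Finset.sum_range]
  -- The coefficients are nonnegative, so each is at most the value at `ρ = 1`. Those values
  -- converge, hence are bounded, and a subsequence of the coefficient vectors converges.
  obtain ⟨M, hM⟩ := (hlim 1 zero_le_one).bddAbove_range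
  have hmem : ∀ m, (fun i : Fin (n + 1) => (p m).coeff i) ∈
      Icc (0 : Fin (n + 1) → ℝ) (fun _ => M) := by
    refine fun m => ⟨fun i => hp m i, fun i => ?_⟩
    refine le_trans ?_ (hM ⟨m, rfl⟩)
    simp only
    rw [hp' m 1 zero_le_one, heval]
    simp only [one_pow, mul_one]
    exact Finset.single_le_sum (f := fun i : Fin (n + 1) => (p m).coeff i) (fun i _ => hp m i)
      (Finset.mem_univ i)
  obtain ⟨c, hcmem, φ, hφ, hcφ⟩ := isCompact_Icc.tendsto_subseq hmem
  refine ⟨fun i => c i / n.choose i, fun i => div_nonneg (hcmem.1 i) (Nat.cast_nonneg _), ?_⟩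
  intro ρ hρ
  refine tendsto_nhds_unique ((hlim ρ hρ).comp hφ.tendsto_atTop) ?_
  have h1 : Tendsto (fun m => ∑ i : Fin (n + 1), (p (φ m)).coeff i * ρ ^ (i : ℕ)) atTop
      (𝓝 (∑ i : Fin (n + 1), c i * ρ ^ (i : ℕ))) :=
    tendsto_finsetSum _ fun i _ => ((tendsto_pi_nhds.1 hcφ) i).mul_const _
  convert h1 using 2
  · simp only [Function.comp_apply]
    rw [hp' _ ρ hρ, heval]
  · refine Finset.sum_congr rfl fun i _ => ?_
    have h0 : (n.choose (i : ℕ) : ℝ) ≠ 0 := by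
      exact_mod_cast (Nat.choose_pos (Nat.lt_succ_iff.mp i.2)).ne'
    rw [mul_div_cancel₀ _ h0]

theorem steinerExpansion_quermassintegral (hK : Convex ℝ K) (hc : IsCompact K) :
    SteinerExpansion K fun i => quermassintegral i K := by
  obtain ⟨W, -, hW⟩ := exists_steinerExpansion hK hc
  have h : ∃ W, SteinerExpansion K W := ⟨W, hW⟩
  have : (fun i => quermassintegral i K) = h.choose := by
    funext i
    rw [quermassintegral, dif_pos h]
  rw [this]
  exact h.choose_spec

theorem quermassintegral_nonneg (hK : Convex ℝ K) (hc : IsCompact K) (i : Fin (n + 1)) :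
    0 ≤ quermassintegral i K := by
  obtain ⟨W, h0, hW⟩ := exists_steinerExpansion hK hc
  have := congrFun ((steinerExpansion_quermassintegral hK hc).unique hW) i
  rw [this]
  exact h0 i

/-- The segment is connected, covered by two closed sets, and meets both. -/
theorem exists_mem_segment_inter {E : Type*} [AddCommGroup E] [Module ℝ E] [TopologicalSpace E]
    [ContinuousAdd E] [ContinuousSMul ℝ E] {K L : Set E} (hK : IsClosed K) (hL : IsClosed L)
    (hKL : Convex ℝ (K ∪ L)) {x y : E} (hx : x ∈ K) (hy : y ∈ L) :
    ∃ z ∈ segment ℝ x y, z ∈ K ∩ L :=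
  isPreconnected_closed_iff.1 (convex_segment x y).isPreconnected K L hK hL
    (hKL.segment_subset (Or.inl hx) (Or.inr hy)) ⟨x, left_mem_segment ℝ x y, hx⟩
    ⟨y, right_mem_segment ℝ x y, hy⟩

theorem inter_add_eq_of_convex_union {E : Type*} [AddCommGroup E] [Module ℝ E]
    [TopologicalSpace E] [ContinuousAdd E] [ContinuousSMul ℝ E] {K L B : Set E} (hK : IsClosed K)
    (hL : IsClosed L) (hKL : Convex ℝ (K ∪ L)) (hB : Convex ℝ B) :
    K ∩ L + B = (K + B) ∩ (L + B) := by
  refine subset_antisymm (inter_add_subset) ?_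
  rintro x ⟨⟨k, hk, b, hb, rfl⟩, l, hl, b', hb', heq⟩
  -- With `z = p • k + q • l` in `K ∩ L`, the common point `k + b = l + b'` equals `z + (p • b + q •
  -- b')`.
  obtain ⟨_, ⟨p, q, hp, hq, hpq, rfl⟩, hz⟩ := exists_mem_segment_inter hK hL hKL hk hl
  refine ⟨_, hz, _, hB hb hb' hp hq hpq, ?_⟩
  have h1 : p • (k + b) + q • (l + b') = k + b := by
    simp only at heq
    rw [heq, ← add_smul, hpq, one_smul]
  simp only
  rw [← h1]
  module

theorem quermassintegral_inter_add_union {L : Set (EuclideanSpace ℝ (Fin n))} (hK : Convex ℝ K)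
    (hcK : IsCompact K) (hL : Convex ℝ L) (hcL : IsCompact L) (hKL : Convex ℝ (K ∪ L))
    (i : Fin (n + 1)) :
    quermassintegral i (K ∩ L) + quermassintegral i (K ∪ L) =
      quermassintegral i K + quermassintegral i L := by
  have h1 := steinerExpansion_quermassintegral hK hcK
  have h2 := steinerExpansion_quermassintegral hL hcL
  have h3 := steinerExpansion_quermassintegral hKL (hcK.union hcL)
  have h4 := steinerExpansion_quermassintegral (hK.inter hL) (hcK.inter hcL)
  have h5 : SteinerExpansion (K ∩ L) fun i =>
      quermassintegral i K + quermassintegral i L - quermassintegral i (K ∪ L) := by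
    intro ρ hρ
    have hB := isCompact_closedBall (0 : EuclideanSpace ℝ (Fin n)) 1 |>.smul ρ
    have hm := measure_union_add_inter (μ := volume)
      (K + ρ • Metric.closedBall (0 : EuclideanSpace ℝ (Fin n)) 1) (hcL.add hB).measurableSet
    rw [← union_add, ← inter_add_eq_of_convex_union hcK.isClosed hcL.isClosed hKL
      ((convex_closedBall _ _).smul ρ)] at hm
    have hm' := congrArg ENNReal.toReal hm
    rw [ENNReal.toReal_add ((hcK.union hcL).add hB).measure_lt_top.ne
      ((hcK.inter hcL).add hB).measure_lt_top.ne,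
      ENNReal.toReal_add (hcK.add hB).measure_lt_top.ne (hcL.add hB).measure_lt_top.ne,
      h1 ρ hρ, h2 ρ hρ, h3 ρ hρ] at hm'
    rw [← eq_sub_iff_add_eq'] at hm'
    rw [hm', ← Finset.sum_add_distrib, ← Finset.sum_sub_distrib]
    exact Finset.sum_congr rfl fun i _ => by ring
  have := congrFun (h4.unique h5) i
  linarith

end

/-! ### Superlevel sets and measurability in the level. -/

section

variable {n : ℕ}

/-- The quermassintegrals of a compact convex set are fixed linear combinations of volumes of its
parallel bodies. -/
theorem exists_quermassintegral_eq_sum (i : Fin (n + 1)) : ∃ a : ℕ → ℝ,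
    ∀ K : Set (EuclideanSpace ℝ (Fin n)), Convex ℝ K → IsCompact K → quermassintegral i K =
      ∑ j ∈ Finset.range (n + 1),
        a j * (volume (K + (j : ℝ) • Metric.closedBall (0 : EuclideanSpace ℝ (Fin n)) 1)).toReal := by
  classical
  have hne : (n.choose (i : ℕ) : ℝ) ≠ 0 := by
    exact_mod_cast (Nat.choose_pos (Nat.lt_succ_iff.mp i.2)).ne'
  -- The Steiner polynomial has degree at most `n`, so interpolation at `0, …, n` recovers its
  -- coefficients.
  refine ⟨fun j => (Lagrange.basis (Finset.range (n + 1)) (fun k : ℕ => (k : ℝ)) j).coeff i /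
    n.choose i, fun K hK hc => ?_⟩
  have hW := steinerExpansion_quermassintegral hK hc
  let p : Polynomial ℝ := ∑ k : Fin (n + 1),
    Polynomial.monomial (k : ℕ) ((n.choose (k : ℕ) : ℝ) * quermassintegral k K)
  have hcoeff : p.coeff i = n.choose i * quermassintegral i K := by
    simp [p, Polynomial.finsetSum_coeff, Polynomial.coeff_monomial, Fin.val_inj]
  have hdeg : p.degree < (Finset.range (n + 1)).card := by
    rw [Finset.card_range]
    refine (Polynomial.degree_sum_le _ _).trans_lt ?_
    rw [Finset.sup_lt_iff (WithBot.bot_lt_coe _)]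
    intro k _
    exact (Polynomial.degree_monomial_le _ _).trans_lt (by exact_mod_cast k.2)
  have heval : ∀ j : ℕ, p.eval (j : ℝ) =
      (volume (K + (j : ℝ) • Metric.closedBall (0 : EuclideanSpace ℝ (Fin n)) 1)).toReal := by
    intro j
    rw [hW j (Nat.cast_nonneg j)]
    simp [p, Polynomial.eval_finsetSum]
  have h := Lagrange.eq_interpolate (v := fun k : ℕ => (k : ℝ))
    (Nat.cast_injective.injOn (s := (Finset.range (n + 1) : Set ℕ))) hdeg
  have h' := congrArg (fun q => Polynomial.coeff q i) h
  simp only [Lagrange.interpolate_apply, Polynomial.finsetSum_coeff, Polynomial.coeff_C_mul,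
    hcoeff, heval] at h'
  rw [eq_comm, ← mul_right_inj' hne, h', Finset.mul_sum]
  refine Finset.sum_congr rfl fun j _ => ?_
  field_simp

variable {f g : EuclideanSpace ℝ (Fin n) → ℝ≥0∞}

theorem IsQFunction.convex_superlevel (hf : IsQFunction f) (t : ℝ≥0∞) : Convex ℝ {x | t ≤ f x} := by
  simpa using hf.quasiconcave t

theorem IsQFunction.isCompact_superlevel (hf : IsQFunction f) {t : ℝ≥0∞} (ht : 0 < t) :
    IsCompact {x | t ≤ f x} := by
  refine Metric.isCompact_of_isClosed_isBounded (hf.upperSemicontinuous.isClosed_preimage t) ?_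
  rw [← Bornology.isCobounded_compl_iff]
  have := hf.tendsto_zero.eventually (gt_mem_nhds ht)
  filter_upwards [this] with x hx
  simpa using hx

theorem IsQFunction.inf (hf : IsQFunction f) (hg : IsQFunction g) (hfg : IsQFunction (f ⊔ g)) :
    IsQFunction (f ⊓ g) where
  ne_zero h := by
    obtain ⟨x, hx⟩ := Function.ne_iff.1 hf.ne_zero
    obtain ⟨y, hy⟩ := Function.ne_iff.1 hg.ne_zero
    -- At this level both superlevel sets are nonempty and their union is convex, so they share a
    -- point, where `f ⊓ g` is positive.
    have ht : 0 < f x ⊓ g y := lt_min (pos_iff_ne_zero.2 hx) (pos_iff_ne_zero.2 hy)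
    have hunion := hfg.convex_superlevel (f x ⊓ g y)
    simp only [Pi.sup_apply, le_sup_iff, ofPred_or] at hunion
    obtain ⟨z, -, hz⟩ := exists_mem_segment_inter (hf.isCompact_superlevel ht).isClosed
      (hg.isCompact_superlevel ht).isClosed hunion (x := x) (y := y)
      (inf_le_left (α := ℝ≥0∞)) (inf_le_right (α := ℝ≥0∞))
    exact (ht.trans_le (le_inf hz.1 hz.2)).ne' (congrFun h z)
  quasiconcave := hf.quasiconcave.inf hg.quasiconcave
  upperSemicontinuous := hf.upperSemicontinuous.inf hg.upperSemicontinuous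
  tendsto_zero := by
    refine tendsto_of_tendsto_of_tendsto_of_le_of_le tendsto_const_nhds hf.tendsto_zero
      (fun _ => zero_le) fun x => inf_le_left

/-- Volumes of parallel bodies of superlevel sets are antitone in `t`, hence measurable. `W_i` is a
linear combination of them for `t > 0`, where the superlevel sets are compact. -/
theorem IsQFunction.aemeasurable_quermassintegral (hf : IsQFunction f) (i : Fin (n + 1)) :
    AEMeasurable (fun t : ℝ => ENNReal.ofReal (quermassintegral i {x | ENNReal.ofReal t ≤ f x}))
      (volume.restrict (Ioi 0)) := by
  obtain ⟨a, ha⟩ := exists_quermassintegral_eq_sum i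
  have hmeas : Measurable fun t : ℝ => ENNReal.ofReal (∑ j ∈ Finset.range (n + 1),
      a j * (volume ({x | ENNReal.ofReal t ≤ f x} +
        (j : ℝ) • Metric.closedBall (0 : EuclideanSpace ℝ (Fin n)) 1)).toReal) := by
    refine ENNReal.measurable_ofReal.comp (Finset.measurable_fun_sum _ fun j _ => ?_)
    refine (ENNReal.measurable_toReal.comp (Antitone.measurable ?_)).const_mul _
    intro s t hst
    exact measure_mono (add_subset_add_right fun x hx => (ENNReal.ofReal_le_ofReal hst).trans hx)
  refine hmeas.aemeasurable.congr ?_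
  filter_upwards [ae_restrict_mem measurableSet_Ioi] with t ht
  rw [ha _ (hf.convex_superlevel _) (hf.isCompact_superlevel (ENNReal.ofReal_pos.2 ht))]

end

theorem proposition5p6 (n : ℕ) (f g : EuclideanSpace ℝ (Fin n) → ℝ≥0∞)
    (hf : IsQFunction f) (hg : IsQFunction g) (hfg : IsQFunction (f ⊔ g)) :
    IsQFunction (f ⊓ g) ∧
      ∀ i : Fin (n + 1),
        functionalQuermassintegral i (f ⊓ g) + functionalQuermassintegral i (f ⊔ g) =
          functionalQuermassintegral i f + functionalQuermassintegral i g := by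
  have hinf := hf.inf hg hfg
  refine ⟨hinf, fun i => ?_⟩
  simp only [functionalQuermassintegral]
  rw [← lintegral_add_left' (hinf.aemeasurable_quermassintegral i),
    ← lintegral_add_left' (hf.aemeasurable_quermassintegral i)]
  refine setLIntegral_congr_fun measurableSet_Ioi fun t ht => ?_
  have ht' : 0 < ENNReal.ofReal t := ENNReal.ofReal_pos.2 ht
  have nonneg : ∀ {φ : EuclideanSpace ℝ (Fin n) → ℝ≥0∞}, IsQFunction φ →
      0 ≤ quermassintegral i {x | ENNReal.ofReal t ≤ φ x} := fun hφ =>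
    quermassintegral_nonneg (hφ.convex_superlevel _) (hφ.isCompact_superlevel ht') i
  rw [← ENNReal.ofReal_add (nonneg hinf) (nonneg hfg), ← ENNReal.ofReal_add (nonneg hf) (nonneg hg)]
  have hunion := hfg.convex_superlevel (ENNReal.ofReal t)
  simp only [Pi.sup_apply, Pi.inf_apply, le_sup_iff, le_inf_iff, ofPred_or, ofPred_and] at hunion ⊢
  rw [quermassintegral_inter_add_union (hf.convex_superlevel _) (hf.isCompact_superlevel ht')
    (hg.convex_superlevel _) (hg.isCompact_superlevel ht') hunion]
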